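/- Setting. Let $\mathcal H$ and $\mathcal K$ be complex Hilbert spaces and let $F\colon\mathcal H\to\mathcal K$ be a rigging operator, that is, a closed densely defined (possibly unbounded) operator with $\ker F=0$ and $\ker F^*=0$. Let $\mathcal A_0$ be the real vector space of operators $V=F^*JF$, where $J$ runs over a given real vector space of bounded self-adjoint operators on $\mathcal K$, and let $\mathcal A=H+\mathcal A_0$ be an affine space consisting of self-adjoint operators on $\mathcal H$. Write $R_z(A)=(A-z)^{-1}$. Assume that $\mathrm{dom}(H)\subset\mathrm{dom}(F)$ and $\mathrm{dom}(H)\subset\mathrm{dom}(V)$ for all $V\in\mathcal A_0$ (so that all operators from $\mathcal A$ have the same domain), and that for every non-real $z$, every $V\in\mathcal A_0$ and every $A\in\mathcal A$ the operators $R_z(H)V$ and $FR_z(A)F^*$ are bounded and their continuous prolongings to $\mathcal H$, respectively to $\mathcal K$, are compact; the latter prolonging is denoted by $T_z(A)$. An operator $A\in\mathcal A$ is called regular at $\lambda\in\mathbb R$ if the limit $T_{\lambda+i0}(A)=\lim_{y\to0^+}T_{\lambda+iy}(A)$ exists in the operator norm, and $\lambda$ is called essentially regular if at least one operator from $\mathcal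 A$ is regular at $\lambda$. Theorem. Let $\lambda\in\mathbb R$ be essentially regular, let $H_0\in\mathcal A$, let $V=F^*JF\in\mathcal A_0$, put $H_s=H_0+sV$ for $s\in\mathbb R$, let $r_\lambda\in\mathbb R$, and let $r\in\mathbb R$ be such that $H_r$ is regular at $\lambda$. (1) If $\lambda$ is an eigenvalue of $H_{r_\lambda}$ with eigenvector $\chi\neq0$, then $\chi\in\mathrm{dom}(F)$, and the vector $u=F\chi$ is non-zero and satisfies $$\bigl(1+(r_\lambda-r)\,T_{\lambda+i0}(H_r)J\bigr)u=0.$$ (2) Consequently, $$\dim\{\chi\in\mathrm{dom}(H_{r_\lambda})\colon H_{r_\lambda}\chi=\lambda\chi\}\ \le\ \dim\Upsilon^1_{\lambda+i0}(r_\lambda),$$ where $\Upsilon^1_{\lambda+i0}(r_\lambda)=\{u\in\mathcal K\colon(1+(r_\lambda-r)T_{\lambda+i0}(H_r)J)u=0\}$; that is, the geometric multiplicity of $\lambda$ as an eigenvalue of $H_{r_\lambda}$ does not exceed $\dim\Upsilon^1_{\lambda+i0}(r_\lambda)$. -/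

import Mathlib

open Filter Topology

universe u v w

noncomputable section

namespace SandwichedResolvent


variable {E : Type u} [NormedAddCommGroup E] [InnerProductSpace ℂ E]
variable {G : Type v} [NormedAddCommGroup G] [InnerProductSpace ℂ G]
variable {L : Type w} [NormedAddCommGroup L] [InnerProductSpace ℂ L]

/-- The product `B A` of two partially defined operators on its natural domain
`{x ∈ dom A : A x ∈ dom B}`. -/
def pcomp (B : G →ₗ.[ℂ] L) (A : E →ₗ.[ℂ] G) : E →ₗ.[ℂ] L where
  domain :=
    { carrier := {x | ∃ h : x ∈ A.domain, A ⟨x, h⟩ ∈ B.domain}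
      zero_mem' := ⟨A.domain.zero_mem, by
        have h : A ⟨0, A.domain.zero_mem⟩ = 0 := A.map_zero
        rw [h]; exact B.domain.zero_mem⟩
      add_mem' := by
        rintro x y ⟨hx, hx'⟩ ⟨hy, hy'⟩
        refine ⟨A.domain.add_mem hx hy, ?_⟩
        have h : A ⟨x + y, A.domain.add_mem hx hy⟩ = A ⟨x, hx⟩ + A ⟨y, hy⟩ :=
          A.map_add ⟨x, hx⟩ ⟨y, hy⟩
        rw [h]; exact B.domain.add_mem hx' hy'
      smul_mem' := by
        rintro c x ⟨hx, hx'⟩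
        refine ⟨A.domain.smul_mem c hx, ?_⟩
        have h : A ⟨c • x, A.domain.smul_mem c hx⟩ = c • A ⟨x, hx⟩ := A.map_smul c ⟨x, hx⟩
        rw [h]; exact B.domain.smul_mem c hx' }
  toFun :=
    { toFun := fun x => B ⟨A ⟨x, x.2.fst⟩, x.2.snd⟩
      map_add' := by
        intro x y
        rw [← B.map_add]
        congr 1
        exact Subtype.ext (A.map_add ⟨x, x.2.fst⟩ ⟨y, y.2.fst⟩)
      map_smul' := by
        intro c x
        rw [RingHom.id_apply, ← B.map_smul]
        congr 1
        exact Subtype.ext (A.map_smul c ⟨x, x.2.fst⟩) }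

/-- `C` is an everywhere defined bounded operator which prolongs `A`. -/
def Prolongs (C : E →L[ℂ] G) (A : E →ₗ.[ℂ] G) : Prop :=
  ∀ x : A.domain, C x = A x

/-- `A` has a bounded prolonging to the whole space which is a compact operator. -/
def HasCompactProlonging (A : E →ₗ.[ℂ] G) : Prop :=
  ∃ C : E →L[ℂ] G, Prolongs C A ∧ IsCompactOperator C

open Classical in
/-- The continuous prolonging of `A` to the whole space. It is unique when `A` is densely defined
and bounded; the value is `0` when there is none. -/
def prolonging (A : E →ₗ.[ℂ] G) : E →L[ℂ] G :=
  if h : ∃ C : E →L[ℂ] G, Prolongs C A then h.choose else 0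

/-- The resolvent `R_z(H) = (H - z)⁻¹`, defined on the range of `H - z`. -/
def resolventOp (H : E →ₗ.[ℂ] E) (z : ℂ) : E →ₗ.[ℂ] E :=
  ((-z • (LinearMap.id : E →ₗ[ℂ] E)) +ᵥ H).inverse

/-- The eigenspace `{χ ∈ dom H : H χ = μ χ}` of a partially defined operator. -/
def eigenspace (H : E →ₗ.[ℂ] E) (μ : ℂ) : Submodule ℂ E where
  carrier := {χ | ∃ h : χ ∈ H.domain, H ⟨χ, h⟩ = μ • χ}
  zero_mem' := ⟨H.domain.zero_mem, by
    have h : H ⟨0, H.domain.zero_mem⟩ = 0 := H.map_zero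
    rw [h, smul_zero]⟩
  add_mem' := by
    rintro x y ⟨hx, hx'⟩ ⟨hy, hy'⟩
    refine ⟨H.domain.add_mem hx hy, ?_⟩
    have h : H ⟨x + y, H.domain.add_mem hx hy⟩ = H ⟨x, hx⟩ + H ⟨y, hy⟩ :=
      H.map_add ⟨x, hx⟩ ⟨y, hy⟩
    rw [h, hx', hy', smul_add]
  smul_mem' := by
    rintro c x ⟨hx, hx'⟩
    refine ⟨H.domain.smul_mem c hx, ?_⟩
    have h : H ⟨c • x, H.domain.smul_mem c hx⟩ = c • H ⟨x, hx⟩ := H.map_smul c ⟨x, hx⟩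
    rw [h, hx', smul_comm]

variable {ℋ : Type u} [NormedAddCommGroup ℋ] [InnerProductSpace ℂ ℋ] [CompleteSpace ℋ]
variable {𝒦 : Type v} [NormedAddCommGroup 𝒦] [InnerProductSpace ℂ 𝒦] [CompleteSpace 𝒦]

/-- A rigging operator: a closed densely defined operator with trivial kernel and co-kernel. -/
structure IsRigging (F : ℋ →ₗ.[ℂ] 𝒦) : Prop where
  isClosed : F.IsClosed
  dense_domain : Dense (F.domain : Set ℋ)
  ker_trivial : ∀ x : F.domain, F x = 0 → (x : ℋ) = 0
  coker_trivial : ∀ φ : F.adjoint.domain, F.adjoint φ = 0 → (φ : 𝒦) = 0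

/-- The perturbation `V = F* J F` on its natural domain. -/
def perturbation (F : ℋ →ₗ.[ℂ] 𝒦) (J : 𝒦 →L[ℂ] 𝒦) : ℋ →ₗ.[ℂ] ℋ :=
  pcomp F.adjoint ((J : 𝒦 →ₗ[ℂ] 𝒦).compPMap F)

/-- The affine space `𝒜 = H + 𝒜₀(F)`, `𝒜₀(F) = {F* J F : J ∈ 𝒥}`. -/
def affineSpace (F : ℋ →ₗ.[ℂ] 𝒦) (𝒥 : Submodule ℝ (𝒦 →L[ℂ] 𝒦)) (H : ℋ →ₗ.[ℂ] ℋ) :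
    Set (ℋ →ₗ.[ℂ] ℋ) :=
  {A | ∃ J ∈ 𝒥, A = H + perturbation F J}

/-- The line `H_r = H₀ + r V` with `V = F* J F`. -/
def line (F : ℋ →ₗ.[ℂ] 𝒦) (H₀ : ℋ →ₗ.[ℂ] ℋ) (J : 𝒦 →L[ℂ] 𝒦) (r : ℝ) : ℋ →ₗ.[ℂ] ℋ :=
  H₀ + (r : ℂ) • perturbation F J

/-- The operator `F R_z(H) F*` on its natural domain. -/
def sandwich (F : ℋ →ₗ.[ℂ] 𝒦) (H : ℋ →ₗ.[ℂ] ℋ) (z : ℂ) : 𝒦 →ₗ.[ℂ] 𝒦 :=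
  pcomp F (pcomp (resolventOp H z) F.adjoint)

/-- The sandwiched resolvent `T_z(H)`: the continuous prolonging of `F R_z(H) F*` to `𝒦`. -/
def sandwichedResolvent (F : ℋ →ₗ.[ℂ] 𝒦) (H : ℋ →ₗ.[ℂ] ℋ) (z : ℂ) : 𝒦 →L[ℂ] 𝒦 :=
  prolonging (sandwich F H z)

/-- The assumptions on the pair `(𝒜, F)`, `𝒜 = H + 𝒜₀(F)`, where `𝒜₀(F)` is given by the real
vector space `𝒥` of bounded self-adjoint operators on `𝒦`. -/
structure IsCompatible (F : ℋ →ₗ.[ℂ] 𝒦) (𝒥 : Submodule ℝ (𝒦 →L[ℂ] 𝒦))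
    (H : ℋ →ₗ.[ℂ] ℋ) : Prop where
  rigging : IsRigging F
  selfAdjoint_J : ∀ J ∈ 𝒥, IsSelfAdjoint J
  /-- `𝒜` consists of self-adjoint operators. -/
  selfAdjoint_mem : ∀ A ∈ affineSpace F 𝒥 H, IsSelfAdjoint A
  domain_le_domain_F : H.domain ≤ F.domain
  domain_le_domain_V : ∀ J ∈ 𝒥, H.domain ≤ (perturbation F J).domain
  /-- Every `V` is relatively compact: `R_z(H) V` is bounded with compact prolonging. -/
  relCompact : ∀ J ∈ 𝒥, ∀ z : ℂ, z.im ≠ 0 →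
    HasCompactProlonging (pcomp (resolventOp H z) (perturbation F J))
  /-- `F R_z(A) F*` is bounded with compact prolonging. -/
  sandwich_compact : ∀ A ∈ affineSpace F 𝒥 H, ∀ z : ℂ, z.im ≠ 0 →
    HasCompactProlonging (sandwich F A z)

/-- The set `Λ(H, F)` of all real `x` such that `T_{x + iy}(H)` has a limit in the operator norm as
`y → 0⁺`; the operator `H` is regular at `x` iff `x` belongs to this set. -/
def regularSet (F : ℋ →ₗ.[ℂ] 𝒦) (H : ℋ →ₗ.[ℂ] ℋ) : Set ℝ :=
  {x | ∃ T : 𝒦 →L[ℂ] 𝒦, Tendsto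
    (fun y : ℝ => sandwichedResolvent F H ((x : ℂ) + (y : ℂ) * Complex.I)) (𝓝[>] 0) (𝓝 T)}

/-- The norm limit `T_{x + i0}(H)`, meaningful for `x ∈ Λ(H, F)`. -/
def boundaryResolvent (F : ℋ →ₗ.[ℂ] 𝒦) (H : ℋ →ₗ.[ℂ] ℋ) (x : ℝ) : 𝒦 →L[ℂ] 𝒦 :=
  limUnder (𝓝[>] (0 : ℝ))
    (fun y : ℝ => sandwichedResolvent F H ((x : ℂ) + (y : ℂ) * Complex.I))

/-- The set `Λ(𝒜, F)` of essentially regular points. -/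
def essentiallyRegularSet (F : ℋ →ₗ.[ℂ] 𝒦) (𝒜 : Set (ℋ →ₗ.[ℂ] ℋ)) : Set ℝ :=
  ⋃ A ∈ 𝒜, regularSet F A

/-- The operator `1 + (rₓ - s) T_{x + i0}(H_s) J` of the resonance equation. -/
def resonanceOp (F : ℋ →ₗ.[ℂ] 𝒦) (H₀ : ℋ →ₗ.[ℂ] ℋ) (J : 𝒦 →L[ℂ] 𝒦) (x rₓ s : ℝ) :
    𝒦 →L[ℂ] 𝒦 :=
  ContinuousLinearMap.id ℂ 𝒦 +
    ((rₓ - s : ℝ) : ℂ) • (boundaryResolvent F (line F H₀ J s) x).comp J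

/-- The space `Υ¹_{x + i0}(rₓ)` of solutions `u ∈ 𝒦` of `(1 + (rₓ - s) T_{x + i0}(H_s) J) u = 0`,
computed with the regular point `s` of the line. -/
def resonanceSpace (F : ℋ →ₗ.[ℂ] 𝒦) (H₀ : ℋ →ₗ.[ℂ] ℋ) (J : 𝒦 →L[ℂ] 𝒦) (x rₓ s : ℝ) :
    Submodule ℂ 𝒦 :=
  LinearMap.ker (resonanceOp F H₀ J x rₓ s : 𝒦 →ₗ[ℂ] 𝒦)

end SandwichedResolvent

end

/-! Put `A = H_r` and let `χ` be an eigenvector of `H_{rlam}`. Then `(A - lam) χ = F* φ` with `φ =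
(r - rlam) J F χ`, so the claim is `F χ = T_{lam+i0}(A) φ` (`apply_eq_boundaryResolvent`). For `z =
lam + iy` one has `T_z(A) φ = F χ + iy F R_z(A) χ`, and the error vanishes as `y → 0⁺`:
`im_mul_norm_sq_le` bounds its squared norm by `y ‖T_z(A)‖ ‖χ‖²`, and `‖T_z(A)‖` stays bounded by
regularity. That bound comes from duality and `Im ⟨φ, T_z φ⟩ = Im z ‖R_{z̄} F* φ‖²` on the dense
domain of `F*`. Part (2) follows since `F` is injective and maps the eigenspace into the resonance
space. -/

open scoped InnerProductSpace ComplexConjugate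

/-! ### Adjoints of closed operators and resolvents of self-adjoint ones. -/

namespace LinearPMap

section Adjoint

variable {E : Type*} [NormedAddCommGroup E] [InnerProductSpace ℂ E] [CompleteSpace E]
variable {G : Type*} [NormedAddCommGroup G] [InnerProductSpace ℂ G] [CompleteSpace G]

/-- The adjoint of a closed operator is densely defined. -/
theorem IsClosed.dense_adjoint_domain {T : E →ₗ.[ℂ] G} (hT : T.IsClosed) :
    Dense (T.adjoint.domain : Set G) := by
  rw [Submodule.dense_iff_topologicalClosure_eq_top, Submodule.topologicalClosure_eq_top_iff,
    Submodule.eq_bot_iff]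
  intro v hv
  rw [Submodule.mem_orthogonal] at hv
  -- The graph is moved to the Hilbert product so that `Γᗮᗮ = Γ` applies; `w ∈ Γᗮ` forces `w.snd ∈
  -- dom T*`, hence `(0, v) ⊥ Γᗮ`.
  let Γ : Submodule ℂ (WithLp 2 (E × G)) :=
    T.graph.comap (WithLp.linearEquiv 2 ℂ (E × G)).toLinearMap
  have hmem : ∀ w : WithLp 2 (E × G), w ∈ Γ ↔ (w.fst, w.snd) ∈ T.graph := fun w => Iff.rfl
  have hΓ : _root_.IsClosed (Γ : Set (WithLp 2 (E × G))) :=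
    _root_.IsClosed.preimage (WithLp.prod_continuous_ofLp 2 E G) hT
  have : CompleteSpace Γ := hΓ.completeSpace_coe
  have hv' : WithLp.toLp 2 ((0 : E), v) ∈ Γ := by
    rw [← Submodule.orthogonal_orthogonal Γ, Submodule.mem_orthogonal]
    intro w hw
    rw [Submodule.mem_orthogonal] at hw
    have hw' : ∀ x : T.domain, ⟪-w.fst, (x : E)⟫_ℂ = ⟪w.snd, T x⟫_ℂ := by
      intro x
      have h := inner_eq_zero_symm.1
        (hw (WithLp.toLp 2 ((x : E), T x)) ((hmem _).2 (T.mem_graph x)))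
      rw [WithLp.prod_inner_apply] at h
      rw [inner_neg_left, neg_eq_iff_add_eq_zero]
      exact h
    rw [WithLp.prod_inner_apply]
    simpa using hv w.snd (mem_adjoint_domain_of_exists _ ⟨_, hw'⟩)
  exact T.graph_fst_eq_zero_snd ((hmem _).1 hv') rfl

variable {A : E →ₗ.[ℂ] E}

theorem _root_.IsSelfAdjoint.inner_apply_left (hA : IsSelfAdjoint A) (x y : A.domain) :
    ⟪A x, (y : E)⟫_ℂ = ⟪(x : E), A y⟫_ℂ := by
  have h := adjoint_isFormalAdjoint hA.dense_domain
  rw [isSelfAdjoint_def.mp hA] at h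
  exact h x y

theorem _root_.IsSelfAdjoint.inner_apply_sub_smul (hA : IsSelfAdjoint A) (z : ℂ)
    (x y : A.domain) :
    ⟪(x : E), A y - z • (y : E)⟫_ℂ = ⟪A x - conj z • (x : E), (y : E)⟫_ℂ := by
  rw [inner_sub_left, inner_sub_right, hA.inner_apply_left, inner_smul_left, inner_smul_right,
    Complex.conj_conj]

theorem _root_.IsSelfAdjoint.im_inner_apply_sub_smul (hA : IsSelfAdjoint A) (z : ℂ)
    (x : A.domain) :
    (⟪(x : E), A x - z • (x : E)⟫_ℂ).im = -z.im * ‖(x : E)‖ ^ 2 := by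
  have h : (⟪(x : E), A x⟫_ℂ).im = 0 := by
    rw [← Complex.conj_eq_iff_im, inner_conj_symm]
    exact hA.inner_apply_left x x
  have h2 : ⟪(x : E), (x : E)⟫_ℂ = ((‖(x : E)‖ ^ 2 : ℝ) : ℂ) := by
    rw [inner_self_eq_norm_sq_to_K]; norm_cast
  rw [inner_sub_right, inner_smul_right, Complex.sub_im, h, h2, Complex.im_mul_ofReal]
  ring

/-- Cauchy–Schwarz applied to the preceding identity. For non-real `z` it gives both injectivity and
closed range of `A - z`. -/
theorem _root_.IsSelfAdjoint.abs_im_mul_norm_le (hA : IsSelfAdjoint A) (z : ℂ) (x : A.domain) :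
    |z.im| * ‖(x : E)‖ ≤ ‖A x - z • (x : E)‖ := by
  have h := (Complex.abs_im_le_norm _).trans
    (norm_inner_le_norm (𝕜 := ℂ) (x : E) (A x - z • (x : E)))
  rw [hA.im_inner_apply_sub_smul, abs_mul, abs_neg, abs_of_nonneg (sq_nonneg ‖(x : E)‖)] at h
  rcases (norm_nonneg (x : E)).eq_or_lt with h0 | h0
  · rw [← h0, mul_zero]; exact norm_nonneg _
  · exact le_of_mul_le_mul_left (by linarith) h0

/-- A self-adjoint operator minus a non-real scalar is onto. -/
theorem _root_.IsSelfAdjoint.exists_sub_smul_eq (hA : IsSelfAdjoint A) {z : ℂ} (hz : z.im ≠ 0)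
    (g : E) : ∃ x : A.domain, A x - z • (x : E) = g := by
  have hpos : 0 < |z.im| := abs_pos.2 hz
  let Φ : A.graph →L[ℂ] E :=
    (ContinuousLinearMap.snd ℂ E E - z • ContinuousLinearMap.fst ℂ E E).comp A.graph.subtypeL
  have hΦ : ∀ x : A.domain, Φ ⟨_, A.mem_graph x⟩ = A x - z • (x : E) := fun _ => rfl
  have : CompleteSpace A.graph := (IsSelfAdjoint.isClosed hA).completeSpace_coe
  have hanti : ∃ K, AntilipschitzWith K Φ := by
    -- With `g = (A - z) x`, the constant dominates both `‖x‖ ≤ |Im z|⁻¹ ‖g‖` and `‖A x‖ ≤ (1 + ‖z‖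
    -- |Im z|⁻¹) ‖g‖`, as the graph carries the max norm.
    refine ⟨⟨1 + (1 + ‖z‖) * |z.im|⁻¹, by positivity⟩, Φ.antilipschitz_of_bound ?_⟩
    rintro ⟨p, hp⟩
    obtain ⟨x, hx1, hx2⟩ := (A.mem_graph_iff).1 hp
    obtain rfl : p = ((x : E), A x) := Prod.ext hx1.symm hx2.symm
    rw [hΦ]
    have h1 : ‖(x : E)‖ ≤ |z.im|⁻¹ * ‖A x - z • (x : E)‖ := by
      rw [le_inv_mul_iff₀ hpos]; exact hA.abs_im_mul_norm_le z x
    have h2 : ‖A x‖ ≤ ‖A x - z • (x : E)‖ + ‖z‖ * ‖(x : E)‖ := by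
      rw [← norm_smul]; simpa using norm_add_le (A x - z • (x : E)) (z • (x : E))
    have h3 := mul_le_mul_of_nonneg_left h1 (norm_nonneg z)
    have hg := norm_nonneg (A x - z • (x : E))
    have h4 : 0 ≤ |z.im|⁻¹ * ‖A x - z • (x : E)‖ := by positivity
    have h5 := mul_nonneg (norm_nonneg z) h4
    change max ‖(x : E)‖ ‖A x‖ ≤ (1 + (1 + ‖z‖) * |z.im|⁻¹) * _
    exact max_le (by nlinarith) (by nlinarith)
  obtain ⟨K, hK⟩ := hanti
  have hcl : _root_.IsClosed (Set.range Φ) := hK.isClosed_range Φ.uniformContinuous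
  have htop : LinearMap.range (Φ : A.graph →ₗ[ℂ] E) = ⊤ := by
    have hc : _root_.IsClosed ((LinearMap.range (Φ : A.graph →ₗ[ℂ] E) : Submodule ℂ E) : Set E) :=
      hcl
    rw [← hc.submodule_topologicalClosure_eq, Submodule.topologicalClosure_eq_top_iff,
      Submodule.eq_bot_iff]
    intro v hv
    rw [Submodule.mem_orthogonal] at hv
    -- A vector orthogonal to the range is an eigenvector of `A* = A` for the non-real number `conj
    -- z`, hence zero.
    have hv' : ∀ x : A.domain, ⟪conj z • v, (x : E)⟫_ℂ = ⟪v, A x⟫_ℂ := by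
      intro x
      have h := inner_eq_zero_symm.1 (hv (A x - z • (x : E)) ⟨⟨_, A.mem_graph x⟩, hΦ x⟩)
      rw [inner_sub_right, inner_smul_right] at h
      rw [inner_smul_left, Complex.conj_conj]
      exact (sub_eq_zero.1 h).symm
    have hva : v ∈ A.adjoint.domain := mem_adjoint_domain_of_exists _ ⟨_, hv'⟩
    have hvA : A.adjoint ⟨v, hva⟩ = conj z • v := adjoint_apply_eq hA.dense_domain _ hv'
    have key : ∃ h : v ∈ A.domain, A ⟨v, h⟩ = conj z • v := by
      rw [← isSelfAdjoint_def.mp hA]; exact ⟨hva, hvA⟩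
    obtain ⟨hvd, hAv⟩ := key
    have h := hA.abs_im_mul_norm_le (conj z) ⟨v, hvd⟩
    rw [hAv, sub_self, norm_zero, Complex.conj_im, abs_neg] at h
    exact norm_le_zero_iff.1 (nonpos_of_mul_nonpos_right h hpos)
  obtain ⟨⟨p, hp⟩, hpg⟩ := (LinearMap.range_eq_top.1 htop) g
  obtain ⟨x, hx1, hx2⟩ := (A.mem_graph_iff).1 hp
  refine ⟨x, ?_⟩
  rw [hx1, hx2]
  exact hpg

end Adjoint

end LinearPMap

/-! ### The sandwiched resolvent and its boundary values. -/

namespace SandwichedResolvent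

variable {ℋ : Type*} [NormedAddCommGroup ℋ] [InnerProductSpace ℂ ℋ] [CompleteSpace ℋ]
variable {𝒦 : Type*} [NormedAddCommGroup 𝒦] [InnerProductSpace ℂ 𝒦]

theorem prolongs_prolonging {A : 𝒦 →ₗ.[ℂ] 𝒦} (hA : HasCompactProlonging A) :
    Prolongs (prolonging A) A := by
  have h : ∃ C, Prolongs C A := ⟨_, hA.choose_spec.1⟩
  rw [prolonging, dif_pos h]
  exact h.choose_spec

theorem perturbation_apply (F : ℋ →ₗ.[ℂ] 𝒦) (J : 𝒦 →L[ℂ] 𝒦) (x : (perturbation F J).domain) :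
    perturbation F J x = F.adjoint ⟨J (F ⟨x, x.2.fst⟩), x.2.snd⟩ :=
  rfl


/-- `LinearPMap.inverse` gives the expected values once the kernel is trivial, which
`abs_im_mul_norm_le` guarantees off the real axis. -/
theorem exists_resolventOp_apply {A : ℋ →ₗ.[ℂ] ℋ} (hA : IsSelfAdjoint A) {z : ℂ}
    (hz : z.im ≠ 0) (x : A.domain) {g : ℋ} (hg : A x - z • (x : ℋ) = g) :
    ∃ h : g ∈ (resolventOp A z).domain, resolventOp A z ⟨g, h⟩ = x := by
  let B : ℋ →ₗ.[ℂ] ℋ := (-z • (LinearMap.id : ℋ →ₗ[ℂ] ℋ)) +ᵥ A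
  have hB : ∀ y : A.domain, B y = A y - z • (y : ℋ) := by
    intro y
    change -z • (y : ℋ) + A y = _
    rw [neg_smul, sub_eq_add_neg, add_comm]
  have hker : LinearMap.ker B.toFun = ⊥ := by
    rw [LinearMap.ker_eq_bot']
    intro y hy
    have h := hA.abs_im_mul_norm_le z y
    rw [← hB, show B y = 0 from hy, norm_zero] at h
    exact Subtype.ext (norm_le_zero_iff.1 (nonpos_of_mul_nonpos_right h (abs_pos.2 hz)))
  have hg' : B x = g := (hB x).trans hg
  have hdom : g ∈ (resolventOp A z).domain := by
    change g ∈ B.inverse.domain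
    rw [LinearPMap.inverse_domain]
    exact ⟨x, hg'⟩
  exact ⟨hdom, LinearPMap.inverse_apply_eq hker hg'⟩

/-- If `(A - z) x = F* φ` then `T_z(A) φ = F x`. -/
theorem sandwichedResolvent_apply {F : ℋ →ₗ.[ℂ] 𝒦} {A : ℋ →ₗ.[ℂ] ℋ} (hA : IsSelfAdjoint A)
    {z : ℂ} (hz : z.im ≠ 0) (hS : HasCompactProlonging (sandwich F A z))
    (x : A.domain) (hx : (x : ℋ) ∈ F.domain) (φ : F.adjoint.domain)
    (h : A x - z • (x : ℋ) = F.adjoint φ) :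
    sandwichedResolvent F A z φ = F ⟨x, hx⟩ := by
  obtain ⟨hd, hval⟩ := exists_resolventOp_apply hA hz x h
  have hmem : (φ : 𝒦) ∈ (sandwich F A z).domain := by
    refine ⟨⟨φ.2, hd⟩, ?_⟩
    change resolventOp A z ⟨F.adjoint φ, hd⟩ ∈ F.domain
    rw [hval]
    exact hx
  refine (prolongs_prolonging hS ⟨φ, hmem⟩).trans ?_
  change F ⟨resolventOp A z ⟨F.adjoint φ, hd⟩, _⟩ = _
  congr 1
  exact Subtype.ext hval

variable [CompleteSpace 𝒦]

/-- The bound `Im z ‖F R_z(A)‖² ≤ ‖T_z(A)‖`. -/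
theorem im_mul_norm_sq_le {F : ℋ →ₗ.[ℂ] 𝒦} (hF : IsRigging F) {A : ℋ →ₗ.[ℂ] ℋ}
    (hA : IsSelfAdjoint A) (hAF : A.domain ≤ F.domain) {z : ℂ} (hz : 0 < z.im)
    (hS : HasCompactProlonging (sandwich F A z)) (ψ : A.domain) :
    z.im * ‖F ⟨ψ, hAF ψ.2⟩‖ ^ 2 ≤ ‖sandwichedResolvent F A z‖ * ‖A ψ - z • (ψ : ℋ)‖ ^ 2 := by
  set T := sandwichedResolvent F A z with hT
  set g := A ψ - z • (ψ : ℋ) with hg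
  set w := F ⟨ψ, hAF ψ.2⟩ with hw
  have hadj := LinearPMap.adjoint_isFormalAdjoint hF.dense_domain
  have key : ∀ φ : 𝒦, z.im * ‖⟪φ, w⟫_ℂ‖ ^ 2 ≤ ‖T‖ * ‖φ‖ ^ 2 * ‖g‖ ^ 2 := by
    have hdense := hF.isClosed.dense_adjoint_domain
    intro φ
    refine hdense.induction (P := fun φ => z.im * ‖⟪φ, w⟫_ℂ‖ ^ 2 ≤ ‖T‖ * ‖φ‖ ^ 2 * ‖g‖ ^ 2)
      ?_ (isClosed_le (by fun_prop) (by fun_prop)) φ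
    intro φ hφ
    have hz' : (conj z).im ≠ 0 := by rw [Complex.conj_im]; exact neg_ne_zero.2 hz.ne'
    -- Here `η = R_{z̄} F* φ` carries the duality with `g`, while `ζ = R_z F* φ` identifies `T φ = F
    -- ζ`.
    obtain ⟨η, hη⟩ := hA.exists_sub_smul_eq hz' (F.adjoint ⟨φ, hφ⟩)
    obtain ⟨ζ, hζ⟩ := hA.exists_sub_smul_eq hz.ne' (F.adjoint ⟨φ, hφ⟩)
    have h1 : ⟪φ, w⟫_ℂ = ⟪(η : ℋ), g⟫_ℂ := by
      rw [hg, hA.inner_apply_sub_smul, hη]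
      exact (hadj ⟨φ, hφ⟩ ⟨ψ, hAF ψ.2⟩).symm
    have h2 : ⟪(η : ℋ), F.adjoint ⟨φ, hφ⟩⟫_ℂ = ⟪φ, T φ⟫_ℂ := by
      rw [hT, sandwichedResolvent_apply hA hz.ne' hS ζ (hAF ζ.2) ⟨φ, hφ⟩ hζ]
      rw [← hζ, hA.inner_apply_sub_smul, hη]
      exact hadj ⟨φ, hφ⟩ ⟨ζ, hAF ζ.2⟩
    have h3 : z.im * ‖(η : ℋ)‖ ^ 2 ≤ ‖T‖ * ‖φ‖ ^ 2 := by
      have h := hA.im_inner_apply_sub_smul (conj z) η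
      rw [hη, h2, Complex.conj_im, neg_neg] at h
      rw [← h]
      calc (⟪φ, T φ⟫_ℂ).im ≤ ‖⟪φ, T φ⟫_ℂ‖ := (le_abs_self _).trans (Complex.abs_im_le_norm _)
        _ ≤ ‖φ‖ * ‖T φ‖ := norm_inner_le_norm _ _
        _ ≤ ‖φ‖ * (‖T‖ * ‖φ‖) := by gcongr; exact T.le_opNorm φ
        _ = ‖T‖ * ‖φ‖ ^ 2 := by ring
    calc z.im * ‖⟪φ, w⟫_ℂ‖ ^ 2 ≤ z.im * (‖(η : ℋ)‖ * ‖g‖) ^ 2 := by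
          rw [h1]; gcongr; exact norm_inner_le_norm _ _
      _ = z.im * ‖(η : ℋ)‖ ^ 2 * ‖g‖ ^ 2 := by ring
      _ ≤ ‖T‖ * ‖φ‖ ^ 2 * ‖g‖ ^ 2 := by gcongr
  -- Taking `φ = w` needs the bound beyond `dom F*`, whence the density argument.
  have h := key w
  rw [inner_self_eq_norm_sq_to_K, norm_pow, RCLike.norm_ofReal, abs_norm] at h
  rcases (norm_nonneg w).eq_or_lt with h0 | h0
  · rw [← h0]; simp; positivity
  · refine le_of_mul_le_mul_right ?_ (pow_pos h0 2)
    calc z.im * ‖w‖ ^ 2 * ‖w‖ ^ 2 = z.im * (‖w‖ ^ 2) ^ 2 := by ring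
      _ ≤ ‖T‖ * ‖w‖ ^ 2 * ‖g‖ ^ 2 := h
      _ = ‖T‖ * ‖g‖ ^ 2 * ‖w‖ ^ 2 := by ring

/-- If `A` is regular at `lam`, `χ ∈ dom A` and `(A - lam) χ = F* φ`, then
`F χ = T_{lam + i0}(A) φ`. -/
theorem apply_eq_boundaryResolvent {F : ℋ →ₗ.[ℂ] 𝒦} (hF : IsRigging F) {A : ℋ →ₗ.[ℂ] ℋ}
    (hA : IsSelfAdjoint A) (hAF : A.domain ≤ F.domain)
    (hS : ∀ z : ℂ, z.im ≠ 0 → HasCompactProlonging (sandwich F A z)) {lam : ℝ}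
    (hreg : lam ∈ regularSet F A) (χ : A.domain) (φ : F.adjoint.domain)
    (hχ : A χ - (lam : ℂ) • (χ : ℋ) = F.adjoint φ) :
    F ⟨χ, hAF χ.2⟩ = boundaryResolvent F A lam φ := by
  obtain ⟨T, hT⟩ := hreg
  rw [boundaryResolvent, hT.limUnder_eq]
  have hle : ∀ᶠ y : ℝ in 𝓝[>] 0,
      ‖F ⟨χ, hAF χ.2⟩ -
        sandwichedResolvent F A ((lam : ℂ) + (y : ℂ) * Complex.I) φ‖ ^ 2 ≤
      y * (‖sandwichedResolvent F A ((lam : ℂ) + (y : ℂ) * Complex.I)‖ * ‖(χ : ℋ)‖ ^ 2) := by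
    filter_upwards [self_mem_nhdsWithin] with y hy
    have hy : 0 < y := hy
    set z : ℂ := (lam : ℂ) + (y : ℂ) * Complex.I with hz
    have hzim : z.im = y := by simp [hz]
    have hz0 : z.im ≠ 0 := by rw [hzim]; exact hy.ne'
    obtain ⟨ψ, hψ⟩ := hA.exists_sub_smul_eq hz0 (χ : ℋ)
    -- With `ψ = R_z χ`, the correction `iy ψ` makes up for replacing `lam` by `z`.
    have hx : A (χ + ((y : ℂ) * Complex.I) • ψ) -
        z • ((χ + ((y : ℂ) * Complex.I) • ψ : A.domain) : ℋ) = F.adjoint φ := by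
      rw [A.map_add, A.map_smul, ← hχ]
      have : A ψ = χ + z • (ψ : ℋ) := by rw [← hψ]; abel
      rw [this, hz]
      simp only [Submodule.coe_add, Submodule.coe_smul]
      module
    have happ := sandwichedResolvent_apply hA hz0 (hS z hz0) _ (hAF (Subtype.prop _)) φ hx
    have hsplit : F ⟨_, hAF (χ + ((y : ℂ) * Complex.I) • ψ).2⟩ =
        F ⟨χ, hAF χ.2⟩ + ((y : ℂ) * Complex.I) • F ⟨ψ, hAF ψ.2⟩ := by
      rw [← F.map_smul, ← F.map_add]
      rfl
    rw [happ, hsplit, sub_add_cancel_left, norm_neg, norm_smul, norm_mul, Complex.norm_I, mul_one,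
      Complex.norm_real, Real.norm_of_nonneg hy.le, mul_pow, sq y, mul_assoc]
    have h := im_mul_norm_sq_le hF hA hAF (hzim ▸ hy) (hS z hz0) ψ
    rw [hψ, hzim] at h
    gcongr
  have hlim1 : Tendsto (fun y : ℝ => ‖F ⟨χ, hAF χ.2⟩ -
      sandwichedResolvent F A ((lam : ℂ) + (y : ℂ) * Complex.I) φ‖ ^ 2) (𝓝[>] 0)
      (𝓝 (‖F ⟨χ, hAF χ.2⟩ - T φ‖ ^ 2)) :=
    ((tendsto_const_nhds.sub (((ContinuousLinearMap.apply ℂ 𝒦 (φ : 𝒦)).continuous.tendsto T).comp hT)).norm).pow 2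
  have hlim2 : Tendsto (fun y : ℝ => y *
      (‖sandwichedResolvent F A ((lam : ℂ) + (y : ℂ) * Complex.I)‖ * ‖(χ : ℋ)‖ ^ 2)) (𝓝[>] 0)
      (𝓝 (0 * (‖T‖ * ‖(χ : ℋ)‖ ^ 2))) :=
    (tendsto_id.mono_left nhdsWithin_le_nhds).mul (hT.norm.mul_const _)
  have h := le_of_tendsto_of_tendsto hlim1 hlim2 hle
  rw [zero_mul] at h
  exact sub_eq_zero.1 (norm_eq_zero.1 (pow_eq_zero_iff two_ne_zero |>.1
    (le_antisymm h (sq_nonneg _))))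

variable {F : ℋ →ₗ.[ℂ] 𝒦} {𝒥 : Submodule ℝ (𝒦 →L[ℂ] 𝒦)} {H : ℋ →ₗ.[ℂ] ℋ}

namespace IsCompatible

theorem domain_eq (hc : IsCompatible F 𝒥 H) {A : ℋ →ₗ.[ℂ] ℋ} (hA : A ∈ affineSpace F 𝒥 H) :
    A.domain = H.domain := by
  obtain ⟨J, hJ, rfl⟩ := hA
  exact inf_eq_left.2 (hc.domain_le_domain_V J hJ)

/-- The operators `F* J₀ F + r F* J F` and `F* (J₀ + r J) F` may have different natural domains;
they agree on `dom H`, which lies in all of them. -/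
theorem line_mem (hc : IsCompatible F 𝒥 H) {H₀ : ℋ →ₗ.[ℂ] ℋ} (hH₀ : H₀ ∈ affineSpace F 𝒥 H)
    {J : 𝒦 →L[ℂ] 𝒦} (hJ : J ∈ 𝒥) (r : ℝ) : line F H₀ J r ∈ affineSpace F 𝒥 H := by
  obtain ⟨J₀, hJ₀, rfl⟩ := hH₀
  have hJ' : J₀ + r • J ∈ 𝒥 := 𝒥.add_mem hJ₀ (𝒥.smul_mem r hJ)
  refine ⟨J₀ + r • J, hJ', ?_⟩
  rw [line, add_assoc]
  refine LinearPMap.ext ?_ ?_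
  · change H.domain ⊓ ((perturbation F J₀).domain ⊓ (perturbation F J).domain) =
      H.domain ⊓ (perturbation F (J₀ + r • J)).domain
    rw [inf_eq_left.2 (hc.domain_le_domain_V _ hJ'),
      inf_eq_left.2 (le_inf (hc.domain_le_domain_V _ hJ₀) (hc.domain_le_domain_V _ hJ))]
  · intro x hx hx'
    have h₀ := hc.domain_le_domain_V _ hJ₀ hx.1
    have h₁ := hc.domain_le_domain_V _ hJ hx.1
    have h₂ := hc.domain_le_domain_V _ hJ' hx.1
    change H ⟨x, _⟩ + (perturbation F J₀ ⟨x, h₀⟩ + (r : ℂ) • perturbation F J ⟨x, h₁⟩) =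
      H ⟨x, _⟩ + perturbation F (J₀ + r • J) ⟨x, h₂⟩
    rw [perturbation_apply, perturbation_apply, perturbation_apply, ← F.adjoint.map_smul,
      ← F.adjoint.map_add]
    rfl

end IsCompatible

end SandwichedResolvent

theorem theoremT
    {ℋ : Type u} [NormedAddCommGroup ℋ] [InnerProductSpace ℂ ℋ] [CompleteSpace ℋ]
    {𝒦 : Type v} [NormedAddCommGroup 𝒦] [InnerProductSpace ℂ 𝒦] [CompleteSpace 𝒦]
    (F : ℋ →ₗ.[ℂ] 𝒦) (𝒥 : Submodule ℝ (𝒦 →L[ℂ] 𝒦)) (H : ℋ →ₗ.[ℂ] ℋ)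
    (hpair : SandwichedResolvent.IsCompatible F 𝒥 H)
    (lam : ℝ)
    (hlam : lam ∈ SandwichedResolvent.essentiallyRegularSet F
      (SandwichedResolvent.affineSpace F 𝒥 H))
    (H₀ : ℋ →ₗ.[ℂ] ℋ) (hH₀ : H₀ ∈ SandwichedResolvent.affineSpace F 𝒥 H)
    (J : 𝒦 →L[ℂ] 𝒦) (hJ : J ∈ 𝒥)
    (rlam r : ℝ)
    (hr : lam ∈ SandwichedResolvent.regularSet F (SandwichedResolvent.line F H₀ J r)) :
    (∀ χ : ℋ, χ ≠ 0 →
      χ ∈ SandwichedResolvent.eigenspace (SandwichedResolvent.line F H₀ J rlam) (lam : ℂ) →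
      ∃ hχ : χ ∈ F.domain, F ⟨χ, hχ⟩ ≠ 0 ∧
        F ⟨χ, hχ⟩ + ((rlam - r : ℝ) : ℂ) •
          SandwichedResolvent.boundaryResolvent F (SandwichedResolvent.line F H₀ J r) lam
            (J (F ⟨χ, hχ⟩)) = 0) ∧
    Cardinal.lift.{v} (Module.rank ℂ
      (SandwichedResolvent.eigenspace (SandwichedResolvent.line F H₀ J rlam) (lam : ℂ))) ≤
    Cardinal.lift.{u} (Module.rank ℂ
      (SandwichedResolvent.resonanceSpace F H₀ J lam rlam r)) := by
  have hmem := hpair.line_mem hH₀ hJ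
  have hdom : ∀ s, (SandwichedResolvent.line F H₀ J s).domain = H.domain :=
    fun s => hpair.domain_eq (hmem s)
  have hsub : SandwichedResolvent.eigenspace (SandwichedResolvent.line F H₀ J rlam) (lam : ℂ) ≤
      F.domain := fun χ hχ => hpair.domain_le_domain_F (hdom rlam ▸ hχ.fst)
  have hres : ∀ (χ : ℋ) (hχ : χ ∈ SandwichedResolvent.eigenspace
      (SandwichedResolvent.line F H₀ J rlam) (lam : ℂ)),
      F ⟨χ, hsub hχ⟩ + ((rlam - r : ℝ) : ℂ) •
        SandwichedResolvent.boundaryResolvent F (SandwichedResolvent.line F H₀ J r) lam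
          (J (F ⟨χ, hsub hχ⟩)) = 0 := by
    rintro χ ⟨hd, hE⟩
    have hdH : χ ∈ H.domain := hdom rlam ▸ hd
    have hdA : χ ∈ (SandwichedResolvent.line F H₀ J r).domain := by rw [hdom]; exact hdH
    have hdV := hpair.domain_le_domain_V J hJ hdH
    let φ : F.adjoint.domain := ⟨J (F ⟨χ, hdV.fst⟩), hdV.snd⟩
    have hE' : H₀ ⟨χ, hd.1⟩ + (rlam : ℂ) • F.adjoint φ = (lam : ℂ) • χ := hE
    -- Moving along the line from `rlam` to `r` adds `(r - rlam) V χ`, which lies in the range of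
    -- `F*`.
    have hA : SandwichedResolvent.line F H₀ J r ⟨χ, hdA⟩ - (lam : ℂ) • χ =
        F.adjoint (((r - rlam : ℝ) : ℂ) • φ) := by
      change H₀ ⟨χ, hd.1⟩ + (r : ℂ) • F.adjoint φ - (lam : ℂ) • χ = _
      rw [← hE', F.adjoint.map_smul, Complex.ofReal_sub]
      module
    have h := SandwichedResolvent.apply_eq_boundaryResolvent hpair.rigging
      (hpair.selfAdjoint_mem _ (hmem r)) (hdom r ▸ hpair.domain_le_domain_F)
      (hpair.sandwich_compact _ (hmem r)) hr ⟨χ, hdA⟩ _ hA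
    rw [Submodule.coe_smul, ContinuousLinearMap.map_smul] at h
    refine (congrArg (· + _) h).trans ?_
    rw [← add_smul, ← Complex.ofReal_add, sub_add_sub_cancel, sub_self, Complex.ofReal_zero,
      zero_smul]
  refine ⟨fun χ h0 hχ => ⟨hsub hχ, fun h => h0 (hpair.rigging.ker_trivial _ h), hres χ hχ⟩, ?_⟩
  let Ψ := (F.toFun.comp (Submodule.inclusion hsub)).codRestrict
    (SandwichedResolvent.resonanceSpace F H₀ J lam rlam r) (fun χ => hres χ χ.2)
  refine LinearMap.lift_rank_le_of_injective Ψ ?_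
  rw [← LinearMap.ker_eq_bot, LinearMap.ker_eq_bot']
  intro χ hχ
  exact Subtype.ext (hpair.rigging.ker_trivial _ (congrArg Subtype.val hχ))
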